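/- A graph here is a finite undirected multigraph (parallel edges allowed). A local antimagic labeling of a connected graph $G$ with edge set $E$ is a bijection $f:E\to\{1,\dots,|E|\}$ such that $f^+(x)\ne f^+(y)$ for all adjacent vertices $x,y$, where $f^+(x)$ is the sum of $f(e)$ over all edges $e$ incident to $x$; $\chi_{la}(G)$ is the minimum, over all local antimagic labelings $f$ of $G$, of the number of distinct values of $f^+$ on the vertices. Let $C_n=v_0v_1\cdots v_{n-1}v_0$ be the $n$-cycle with its edges labeled by $f(v_jv_{j+1})=(j+2)/2$ for even $j$ and $f(v_jv_{j+1})=n-(j-1)/2$ for odd $j$ ($0\le j\le n-1$, $v_n=v_0$). Given a family of disjoint blocks of vertices of $C_n$, merge the vertices of each block into one vertex, keeping all $n$ edges and their labels. For $k\ge 2$ define in this way the following graphs; a pair or triple of integers is the block of the vertices with these subscripts, and the blocks are the members of $\mathscr A\cup\mathscr B\cup\mathscr C$. - $G_{4k+2}$: $n=8k+4$; $\mathscr A=\{(2i,4k+2i+2): 0\le i\le 2k\}$; $\mathscr B=\{(2j+1,2k+2j+3): 0\le j\le k\}\cup\{(4k+2j+5,6k+2j+5): 0\le j\le k-1\}$;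 $\mathscr C=\emptyset$. - $G^1_{4k+1}$: $n=8k+2$; $\mathscr A=\{(2i,4k+2i): 1\le i\le 2k\}$; $\mathscr B=\{(2j+1,4k+2j+3): 0\le j\le 2k-1\}$; $\mathscr C=\{(0,4k+1)\}$. - $G^1_{4k+3}$: $n=8k+6$; $\mathscr A=\{(2i,4k+2+2i): 1\le i\le 2k+1\}$; $\mathscr B=\{(2j+1,6k+5+2j): 0\le j\le k\}\cup\{(2k+3+2j,4k+5+2j): 0\le j\le k-1\}$; $\mathscr C=\{(0,4k+3)\}$. - $G^2_{4k+1}$: $n=8k+1$; $\mathscr A=\{(2i,4k+2i): 1\le i\le 2k\}$; $\mathscr B=\{(2j+1,2k+2j+1): 0\le j\le k-1\}\cup\{(4k+2j+1,6k+2j+1): 0\le j\le k-1\}$; $\mathscr C=\{(0)\}$ ($v_0$ is not merged). - $G^2_{4k+3}$: $n=8k+5$; $\mathscr A=\{(2i,4k+2+2i): 1\le i\le 2k+1\}$; $\mathscr B=\{(2j+1,6k+3+2j): 0\le j\le k\}\cup\{(2k+3+2j,4k+3+2j): 0\le j\le k-1\}$; $\mathscr C=\{(0)\}$. - $G^3_{4k+1}$: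 $n=8k+3$; $\mathscr A=\{(2i,4k+2i): 1\le i\le k\}\cup\{(2k+2i,6k+2+2i): 1\le i\le k\}$; $\mathscr B=\{(2j+1,8k+1-2j): 0\le j\le k-1\}\cup\{(2k+3+2j,4k+3+2j): 0\le j\le k-1\}$; $\mathscr C=\{(0,2k+1,6k+2)\}$. - $G^3_{4k+3}$: $n=8k+7$; $\mathscr A=\{(2i,4k+4+2i): 1\le i\le k\}\cup\{(2k+2+2i,6k+4+2i): 1\le i\le k+1\}$; $\mathscr B=\{(4j+1,4k+3+2j): 0\le j\le k\}\cup\{(4j+3,6k+7+2j): 0\le j\le k-1\}$; $\mathscr C=\{(0,2k+2,6k+5)\}$. **Theorem.** Let $k\ge 2$ and let $G$ be any of these seven graphs. Then $\chi_{la}(G)=3$, and $\chi_{la}(G-e)=3$ whenever $e$ is the edge of $G$ that receives the label $1$ or the label $n$. -/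

import Mathlib

/-! ### Local antimagic labelings of finite multigraphs

Graphs are Mathlib's multigraphs `Graph α β`: parallel edges are allowed. -/

namespace LocalAntimagic

/-- The multigraph `G` is connected: it has a vertex, and any two vertices are joined by a walk. -/
def IsConnected {α β : Type*} (G : Graph α β) : Prop :=
  G.vertexSet.Nonempty ∧
    ∀ x ∈ G.vertexSet, ∀ y ∈ G.vertexSet, Relation.ReflTransGen G.Adj x y

/-- The induced vertex label `f⁺(x)`: the sum of `f e` over all edges `e` incident to `x`. -/
noncomputable def vertexLabel {α β : Type*} (G : Graph α β) (f : β → ℕ) (x : α) : ℕ :=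
  ∑ᶠ e ∈ G.incidenceSet x, f e

/-- `f` is a local antimagic labeling of the connected multigraph `G`: it restricts to a bijection
from the edge set onto `{1, …, |E|}`, and adjacent vertices have distinct induced labels. -/
structure IsLocalAntimagic {α β : Type*} (G : Graph α β) (f : β → ℕ) : Prop where
  connected : IsConnected G
  bijOn : Set.BijOn f G.edgeSet (Set.Icc 1 G.edgeSet.ncard)
  ne_of_adj : ∀ x y, G.Adj x y → vertexLabel G f x ≠ vertexLabel G f y

/-- The color number `c(f)`: the number of distinct induced vertex labels. -/
noncomputable def colorNumber {α β : Type*} (G : Graph α β) (f : β → ℕ) : ℕ∞ :=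
  (vertexLabel G f '' G.vertexSet).encard

/-- The local antimagic chromatic number: the minimum of `c(f)` over all local antimagic
labelings `f` of `G` (and `⊤` if there is none). -/
noncomputable def chiLa {α β : Type*} (G : Graph α β) : ℕ∞ :=
  ⨅ (f : β → ℕ) (_ : IsLocalAntimagic G f), colorNumber G f

/-! ### Merging vertices of a labeled cycle -/

/-- The cycle `v₀ v₁ ⋯ v_{n-1} v₀`. The number `j < n` stands for the vertex `v_j`, and also for
the edge `v_j v_{j+1}` (subscripts modulo `n`). -/
def cycle (n : ℕ) : Graph ℕ ℕ where
  vertexSet := Set.Iio n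
  edgeSet := Set.Iio n
  IsLink e x y := e < n ∧ ((x = e ∧ y = (e + 1) % n) ∨ (x = (e + 1) % n ∧ y = e))
  isLink_symm := by
    intro e _
    constructor
    rintro x y ⟨he, h | h⟩
    · exact ⟨he, Or.inr ⟨h.2, h.1⟩⟩
    · exact ⟨he, Or.inl ⟨h.2, h.1⟩⟩
  eq_or_eq_of_isLink_of_isLink := by
    rintro e x y v w ⟨_, ⟨rfl, rfl⟩ | ⟨rfl, rfl⟩⟩ ⟨_, ⟨rfl, rfl⟩ | ⟨rfl, rfl⟩⟩ <;> simp
  edge_mem_iff_exists_isLink := by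
    intro e
    constructor
    · intro he
      exact ⟨e, (e + 1) % n, he, Or.inl ⟨rfl, rfl⟩⟩
    · rintro ⟨x, y, he, _⟩
      exact he
  left_mem_of_isLink := by
    rintro e x y ⟨he, ⟨rfl, _⟩ | ⟨rfl, _⟩⟩
    · exact he
    · exact Nat.mod_lt _ (by omega)

/-- The `C`-labeling of the `n`-cycle: the label of the edge `v_j v_{j+1}`. -/
def cLabel (n j : ℕ) : ℕ := if Even j then (j + 2) / 2 else n - (j - 1) / 2

/-- A merging of vertices of the `n`-cycle: all vertices whose subscripts lie in a common block
are to be merged into one vertex. -/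
structure CycleMerging where
  n : ℕ
  blocks : Set (Set ℕ)

/-- The vertices after merging. -/
def CycleMerging.Vertex (S : CycleMerging) : Type :=
  Quot fun x y : ℕ => ∃ b ∈ S.blocks, x ∈ b ∧ y ∈ b

/-- The multigraph obtained from the `n`-cycle by merging. Its edges are those of the cycle, so
that the `C`-labeling `cLabel S.n` is also a labeling of it. -/
def CycleMerging.graph (S : CycleMerging) : Graph S.Vertex ℕ :=
  (cycle S.n).map (Quot.mk _)

/-! ### The seven constructions

In each of them the three (or two) parts of the union are the families `𝒜`, `ℬ` (and `𝒞`). -/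

/-- `G_{4k+2}(𝒜, ℬ)`, from the cycle of length `8k + 4`. -/
def G0Two (k : ℕ) : CycleMerging where
  n := 8 * k + 4
  blocks :=
    {b | ∃ i, i ≤ 2 * k ∧ b = {2 * i, 4 * k + 2 * i + 2}} ∪
    ({b | ∃ j, j ≤ k ∧ b = {2 * j + 1, 2 * k + 2 * j + 3}} ∪
      {b | ∃ j, j < k ∧ b = {4 * k + 2 * j + 5, 6 * k + 2 * j + 5}})

/-- `G¹_{4k+1}(𝒜, ℬ, 𝒞)`, from the cycle of length `8k + 2`. -/
def G1One (k : ℕ) : CycleMerging where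
  n := 8 * k + 2
  blocks :=
    {b | ∃ i, 1 ≤ i ∧ i ≤ 2 * k ∧ b = {2 * i, 4 * k + 2 * i}} ∪
    {b | ∃ j, j < 2 * k ∧ b = {2 * j + 1, 4 * k + 2 * j + 3}} ∪
    {{0, 4 * k + 1}}

/-- `G¹_{4k+3}(𝒜, ℬ, 𝒞)`, from the cycle of length `8k + 6`. -/
def G1Three (k : ℕ) : CycleMerging where
  n := 8 * k + 6
  blocks :=
    {b | ∃ i, 1 ≤ i ∧ i ≤ 2 * k + 1 ∧ b = {2 * i, 4 * k + 2 + 2 * i}} ∪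
    ({b | ∃ j, j ≤ k ∧ b = {2 * j + 1, 6 * k + 5 + 2 * j}} ∪
      {b | ∃ j, j < k ∧ b = {2 * k + 3 + 2 * j, 4 * k + 5 + 2 * j}}) ∪
    {{0, 4 * k + 3}}

/-- `G²_{4k+1}(𝒜, ℬ, 𝒞)`, from the cycle of length `8k + 1`. -/
def G2One (k : ℕ) : CycleMerging where
  n := 8 * k + 1
  blocks :=
    {b | ∃ i, 1 ≤ i ∧ i ≤ 2 * k ∧ b = {2 * i, 4 * k + 2 * i}} ∪
    ({b | ∃ j, j < k ∧ b = {2 * j + 1, 2 * k + 2 * j + 1}} ∪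
      {b | ∃ j, j < k ∧ b = {4 * k + 2 * j + 1, 6 * k + 2 * j + 1}}) ∪
    {{0}}

/-- `G²_{4k+3}(𝒜, ℬ, 𝒞)`, from the cycle of length `8k + 5`. -/
def G2Three (k : ℕ) : CycleMerging where
  n := 8 * k + 5
  blocks :=
    {b | ∃ i, 1 ≤ i ∧ i ≤ 2 * k + 1 ∧ b = {2 * i, 4 * k + 2 + 2 * i}} ∪
    ({b | ∃ j, j ≤ k ∧ b = {2 * j + 1, 6 * k + 3 + 2 * j}} ∪
      {b | ∃ j, j < k ∧ b = {2 * k + 3 + 2 * j, 4 * k + 3 + 2 * j}}) ∪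
    {{0}}

/-- `G³_{4k+1}(𝒜, ℬ, 𝒞)`, from the cycle of length `8k + 3`. -/
def G3One (k : ℕ) : CycleMerging where
  n := 8 * k + 3
  blocks :=
    ({b | ∃ i, 1 ≤ i ∧ i ≤ k ∧ b = {2 * i, 4 * k + 2 * i}} ∪
      {b | ∃ i, 1 ≤ i ∧ i ≤ k ∧ b = {2 * k + 2 * i, 6 * k + 2 + 2 * i}}) ∪
    ({b | ∃ j, j < k ∧ b = {2 * j + 1, 8 * k + 1 - 2 * j}} ∪
      {b | ∃ j, j < k ∧ b = {2 * k + 3 + 2 * j, 4 * k + 3 + 2 * j}}) ∪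
    {{0, 2 * k + 1, 6 * k + 2}}

/-- `G³_{4k+3}(𝒜, ℬ, 𝒞)`, from the cycle of length `8k + 7`. -/
def G3Three (k : ℕ) : CycleMerging where
  n := 8 * k + 7
  blocks :=
    ({b | ∃ i, 1 ≤ i ∧ i ≤ k ∧ b = {2 * i, 4 * k + 4 + 2 * i}} ∪
      {b | ∃ i, 1 ≤ i ∧ i ≤ k + 1 ∧ b = {2 * k + 2 + 2 * i, 6 * k + 4 + 2 * i}}) ∪
    ({b | ∃ j, j ≤ k ∧ b = {4 * j + 1, 4 * k + 3 + 2 * j}} ∪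
      {b | ∃ j, j < k ∧ b = {4 * j + 3, 6 * k + 7 + 2 * j}}) ∪
    {{0, 2 * k + 2, 6 * k + 5}}

end LocalAntimagic

/-!
Suppose a local antimagic labeling induces only two colors. Then the graph is bipartite, and every
edge label is counted exactly once on either side, so that the two colors times the sizes of the
respective color classes both equal the sum of all labels. This is impossible if merging created
an odd closed walk, if the two sides have the same size, or if there is a pendant vertex whose side
contains at most half as many vertices as there are edges: the color of that vertex is a single
label, hence too small.

For the upper bound, the `C`-labeling induces on the vertices of the cycle a sum that depends only
on the parity of the subscript, except at `v₀`. Since all vertices outside the block of `v₀` are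
merged in pairs of equal parity, three colors remain. Lowering all labels by one, respectively
subtracting them from `n`, preserves this and gives the label `0` to the edge with label `1`,
respectively `n`, which can then be deleted without changing the induced sums.
-/

namespace LocalAntimagic

open scoped Graph

variable {α β γ : Type*} {G : Graph α β} {f : β → ℕ} {v : α}

/-! ### Two-colored labelings and bipartitions -/

/-- `X` is one of the two sides of a bipartition of `G`: every edge has exactly one end in `X`. -/
structure IsBipartitionSide (G : Graph α β) (X : Set α) : Prop where
  subset : X ⊆ V(G)
  mem_iff : ∀ ⦃x y⦄, G.Adj x y → (x ∈ X ↔ y ∉ X)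

lemma finsum_mem_vertexLabel (hE : E(G).Finite) {A : Set α} (hA : A.Finite)
    (hind : A.Pairwise fun x y => ¬ G.Adj x y) :
    ∑ᶠ x ∈ A, vertexLabel G f x = ∑ᶠ e ∈ ⋃ x ∈ A, G.incidenceSet x, f e := by
  refine (finsum_mem_biUnion (fun x hx y hy hxy => ?_) hA fun x _ =>
    hE.subset fun e he => Graph.Inc.edge_mem he).symm
  refine Set.disjoint_left.2 fun e ⟨z, hxz⟩ hey => hind hx hy hxy ⟨e, ?_⟩
  rwa [Graph.Inc.eq_of_isLink_of_ne_left hey hxz hxy.symm]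

lemma IsBipartitionSide.finsum_mem_vertexLabel {X : Set α} (hX : IsBipartitionSide G X)
    (hE : E(G).Finite) (hXfin : X.Finite) :
    ∑ᶠ x ∈ X, vertexLabel G f x = ∑ᶠ e ∈ E(G), f e := by
  rw [LocalAntimagic.finsum_mem_vertexLabel hE hXfin
    fun x hx y hy _ hxy => (hX.mem_iff hxy).1 hx hy]
  congr! 3 with e
  rw [Set.mem_iUnion₂]
  refine ⟨fun ⟨x, _, hex⟩ => Graph.Inc.edge_mem hex, fun he => ?_⟩
  obtain ⟨x, y, hxy⟩ := G.exists_isLink_of_mem_edgeSet he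
  by_cases hx : x ∈ X
  · exact ⟨x, hx, hxy.inc_left⟩
  · exact ⟨y, by simpa using mt (hX.mem_iff ⟨e, hxy⟩).2 hx, hxy.inc_right⟩

namespace IsLocalAntimagic

lemma finite_edgeSet (hf : IsLocalAntimagic G f) : E(G).Finite :=
  hf.bijOn.finite_iff_finite.2 (Set.finite_Icc _ _)

lemma two_mul_finsum_mem_edgeSet (hf : IsLocalAntimagic G f) :
    2 * ∑ᶠ e ∈ E(G), f e = E(G).ncard * (E(G).ncard + 1) := by
  rw [finsum_mem_eq_of_bijOn f hf.bijOn (g := fun i => i) fun _ _ => rfl,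
    ← Finset.coe_Icc, finsum_mem_coe_finset]
  have h := Finset.sum_range_id_mul_two (E(G).ncard + 1)
  rw [Finset.range_eq_Ico, Finset.sum_eq_sum_Ico_succ_bot (by omega)] at h
  simpa [mul_comm, Finset.Ico_add_one_right_eq_Icc] using h

lemma isBipartitionSide (hf : IsLocalAntimagic G f) (hc : colorNumber G f < 3) (hv : v ∈ V(G)) :
    IsBipartitionSide G {x ∈ V(G) | vertexLabel G f x = vertexLabel G f v} where
  subset := Set.sep_subset _ _
  mem_iff := by
    rintro x y hxy
    have hne := hf.ne_of_adj x y hxy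
    refine ⟨fun hx hy => hne (hx.2.trans hy.2.symm), fun hy => ⟨hxy.left_mem, ?_⟩⟩
    by_contra hx
    have hy : vertexLabel G f y ≠ vertexLabel G f v := fun h => hy ⟨hxy.right_mem, h⟩
    refine hc.not_ge (le_of_eq_of_le ?_ (Set.encard_le_encard (Set.insert_subset
      (Set.mem_image_of_mem _ hv) (Set.insert_subset (Set.mem_image_of_mem _ hxy.left_mem)
      (Set.singleton_subset_iff.2 (Set.mem_image_of_mem _ hxy.right_mem))))))
    exact (Set.encard_eq_three.2 ⟨_, _, _, Ne.symm hx, hy.symm, hne, rfl⟩).symm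

lemma ncard_mul_vertexLabel (hf : IsLocalAntimagic G f) (hc : colorNumber G f < 3)
    (hV : V(G).Finite) (hv : v ∈ V(G)) :
    {x ∈ V(G) | vertexLabel G f x = vertexLabel G f v}.ncard * vertexLabel G f v =
      ∑ᶠ e ∈ E(G), f e := by
  have hfin := hV.subset (Set.sep_subset V(G) fun x => vertexLabel G f x = vertexLabel G f v)
  rw [← (hf.isBipartitionSide hc hv).finsum_mem_vertexLabel hf.finite_edgeSet hfin,
    finsum_mem_congr rfl fun x hx => hx.2, finsum_mem_eq_finite_toFinset_sum _ hfin,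
    Finset.sum_const, smul_eq_mul, Set.ncard_eq_toFinset_card _ hfin]

end IsLocalAntimagic

lemma three_le_chiLa_of_forall_not_isBipartitionSide (h : ∀ X, ¬ IsBipartitionSide G X) :
    3 ≤ chiLa G := by
  refine le_iInf₂ fun f hf => not_lt.1 fun hc => ?_
  obtain ⟨v, hv⟩ := hf.connected.1
  exact h _ (hf.isBipartitionSide hc hv)

lemma three_le_chiLa_of_ncard_eq (hV : V(G).Finite) {x y : α} (hxy : G.Adj x y) {m : ℕ}
    (h : ∀ X, IsBipartitionSide G X → X.ncard = m) : 3 ≤ chiLa G := by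
  refine le_iInf₂ fun f hf => not_lt.1 fun hc => hf.ne_of_adj x y hxy ?_
  have hx := hf.ncard_mul_vertexLabel hc hV hxy.left_mem
  have hy := hf.ncard_mul_vertexLabel hc hV hxy.right_mem
  have hm : 0 < m := by
    rw [← h _ (hf.isBipartitionSide hc hxy.left_mem)]
    exact (Set.ncard_pos (hV.subset (Set.sep_subset _ _))).2 ⟨x, hxy.left_mem, rfl⟩
  rw [h _ (hf.isBipartitionSide hc hxy.left_mem)] at hx
  rw [h _ (hf.isBipartitionSide hc hxy.right_mem)] at hy
  exact Nat.eq_of_mul_eq_mul_left hm (hx.trans hy.symm)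

lemma three_le_chiLa_of_incidenceSet_eq_singleton (hV : V(G).Finite) (hv : v ∈ V(G)) {e : β}
    (he : G.incidenceSet v = {e})
    (h : ∀ X, IsBipartitionSide G X → v ∈ X → 2 * X.ncard ≤ E(G).ncard) : 3 ≤ chiLa G := by
  refine le_iInf₂ fun f hf => not_lt.1 fun hc => ?_
  have hlabel : vertexLabel G f v = f e := by rw [vertexLabel, he, finsum_mem_singleton]
  obtain ⟨hpos, hle⟩ : f e ∈ Set.Icc 1 E(G).ncard :=
    hf.bijOn.mapsTo (Graph.Inc.edge_mem (he.ge rfl : e ∈ G.incidenceSet v))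
  have hX := h _ (hf.isBipartitionSide hc hv) ⟨hv, rfl⟩
  have hsum := hf.two_mul_finsum_mem_edgeSet
  rw [← hf.ncard_mul_vertexLabel hc hV hv, ← mul_assoc] at hsum
  nlinarith [Nat.mul_le_mul hX (hlabel.trans_le hle)]

/-! ### Identifying vertices and deleting edges -/

lemma vertexLabel_deleteEdges {D : Set β} (hf : ∀ e ∈ D, f e = 0) (v : α) :
    vertexLabel (G.deleteEdges D) f v = vertexLabel G f v := by
  refine finsum_mem_inter_support_eq' _ _ _ fun e he => ?_
  have heD : e ∉ D := fun heD => he (hf e heD)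
  simp only [Graph.mem_incidenceSet, Graph.deleteEdges_inc, heD, not_false_eq_true, and_true]

lemma map_deleteEdges (q : α → γ) (D : Set β) :
    (G.map q).deleteEdges D = (G.deleteEdges D).map q := by
  refine Graph.ext rfl fun e x y => ?_
  simp only [Graph.deleteEdges_isLink, Graph.map_isLink, Relation.Map]
  grind

lemma vertexLabel_map (hE : E(G).Finite) (hV : V(G).Finite) {q : α → γ}
    (hq : ∀ ⦃x y⦄, G.Adj x y → q x ≠ q y) (v : γ) :
    vertexLabel (G.map q) f v = ∑ᶠ x ∈ {x ∈ V(G) | q x = v}, vertexLabel G f x := by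
  rw [finsum_mem_vertexLabel hE (hV.subset (Set.sep_subset _ _))
    fun x hx y hy _ hxy => hq hxy (hx.2.trans hy.2.symm), vertexLabel]
  congr! 3 with e
  simp only [Graph.mem_incidenceSet, Graph.map_inc, Set.mem_iUnion₂, Set.mem_sep_iff]
  exact ⟨fun ⟨x, hex, hxv⟩ => ⟨x, ⟨hex.vertex_mem, hxv.symm⟩, hex⟩,
    fun ⟨x, hx, hex⟩ => ⟨x, hex, hx.2.symm⟩⟩

lemma IsConnected.map (hG : IsConnected G) (q : α → γ) : IsConnected (G.map q) := by
  refine ⟨hG.1.image q, ?_⟩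
  rintro _ ⟨x, hx, rfl⟩ _ ⟨y, hy, rfl⟩
  exact (hG.2 x hx y hy).lift q fun _ _ h => h.map q

lemma IsBipartitionSide.preimage {q : α → γ} {X : Set γ} (hX : IsBipartitionSide (G.map q) X) :
    IsBipartitionSide G {x ∈ V(G) | q x ∈ X} where
  subset := Set.sep_subset _ _
  mem_iff x y hxy := by
    have h := hX.mem_iff (hxy.map q)
    simpa only [Set.mem_sep_iff, hxy.left_mem, hxy.right_mem, true_and] using h

/-! ### The cycle and its `C`-labeling -/

section Cycle

variable {n d e x y a b c : ℕ} {D Y : Set ℕ} {w : ℕ → ℕ}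

lemma cycle_isLink_iff : (cycle n).IsLink e x y ↔
    e + 1 < n ∧ (x = e ∧ y = e + 1 ∨ x = e + 1 ∧ y = e) ∨
      e + 1 = n ∧ (x = e ∧ y = 0 ∨ x = 0 ∧ y = e) := by
  change e < n ∧ (x = e ∧ y = (e + 1) % n ∨ x = (e + 1) % n ∧ y = e) ↔ _
  rcases lt_trichotomy (e + 1) n with h | rfl | h
  · rw [Nat.mod_eq_of_lt h]; omega
  · rw [Nat.mod_self]; omega
  · omega

lemma cycle_inc_iff : (cycle n).Inc e x ↔
    e < n ∧ (x = e ∨ x = e + 1 ∧ e + 1 < n ∨ x = 0 ∧ e + 1 = n) := by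
  simp only [Graph.Inc, cycle_isLink_iff]
  constructor
  · rintro ⟨y, h⟩; omega
  · rintro ⟨_, h⟩
    obtain hlt | hlt : e + 1 < n ∨ e + 1 = n := by omega
    · exact ⟨2 * e + 1 - x, by omega⟩
    · exact ⟨e - x, by omega⟩

lemma vertexLabel_cycle_of_pos (hx : 0 < x) (hxn : x < n) :
    vertexLabel (cycle n) w x = w (x - 1) + w x := by
  have hset : (cycle n).incidenceSet x = {x - 1, x} := by
    ext e
    rw [Graph.mem_incidenceSet, cycle_inc_iff, Set.mem_insert_iff, Set.mem_singleton_iff]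
    omega
  rw [vertexLabel, hset, finsum_mem_pair (by omega)]

lemma incidenceSet_cycle_zero (hn : 0 < n) : (cycle n).incidenceSet 0 = {0, n - 1} := by
  ext e
  rw [Graph.mem_incidenceSet, cycle_inc_iff, Set.mem_insert_iff, Set.mem_singleton_iff]
  omega

lemma vertexLabel_cycle_zero (hn : 2 ≤ n) : vertexLabel (cycle n) w 0 = w 0 + w (n - 1) := by
  rw [vertexLabel, incidenceSet_cycle_zero (by omega), finsum_mem_pair (by omega)]

lemma adj_cycle_deleteEdges_succ (hx : x + 1 < n) (hxD : x ∉ D) :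
    ((cycle n).deleteEdges D).Adj x (x + 1) :=
  ⟨x, cycle_isLink_iff.2 (by omega), hxD⟩

lemma adj_cycle_deleteEdges_last (hn : 0 < n) (hnD : n - 1 ∉ D) :
    ((cycle n).deleteEdges D).Adj (n - 1) 0 :=
  ⟨n - 1, cycle_isLink_iff.2 (by omega), hnD⟩

lemma reflTransGen_adj_cycle_deleteEdges (hxy : x ≤ y) (hy : y < n)
    (hD : ∀ e ∈ D, e < x ∨ y ≤ e) :
    Relation.ReflTransGen ((cycle n).deleteEdges D).Adj x y := by
  induction y, hxy using Nat.le_induction with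
  | base => exact .refl
  | succ y hxy ih =>
    exact (ih (by omega) fun e he => by have := hD e he; omega).tail
      (adj_cycle_deleteEdges_succ hy fun hyD => by have := hD y hyD; omega)

lemma isConnected_cycle_deleteEdges (hn : 0 < n) (hD : D ⊆ {d}) :
    IsConnected ((cycle n).deleteEdges D) := by
  have : Std.Symm ((cycle n).deleteEdges D).Adj := ⟨fun _ _ h => h.symm⟩
  have key : ∀ x < n, Relation.ReflTransGen ((cycle n).deleteEdges D).Adj x 0 := by
    intro x hx
    by_cases hxd : x ≤ d
    · exact Std.Symm.symm _ _ (reflTransGen_adj_cycle_deleteEdges (Nat.zero_le x) hx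
        fun e he => .inr (by rwa [hD he]))
    · have hlast : n - 1 ∉ D := fun h => by have : n - 1 = d := hD h; omega
      exact (reflTransGen_adj_cycle_deleteEdges (by omega : x ≤ n - 1) (by omega)
        fun e he => .inl (by rw [hD he]; omega)).tail (adj_cycle_deleteEdges_last hn hlast)
  exact ⟨⟨0, hn⟩, fun x hx y hy => (key x hx).trans (Std.Symm.symm _ _ (key y hy))⟩

lemma IsBipartitionSide.mem_iff_of_le (hY : IsBipartitionSide ((cycle n).deleteEdges D) Y)
    (hxy : x ≤ y) (hy : y < n) (hD : ∀ e ∈ D, e < x ∨ y ≤ e) :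
    (y ∈ Y ↔ (x ∈ Y ↔ y % 2 = x % 2)) := by
  induction y, hxy using Nat.le_induction with
  | base => simp
  | succ y hxy ih =>
    have hstep := hY.mem_iff (adj_cycle_deleteEdges_succ hy (D := D) fun hyD => by
      have := hD y hyD; omega)
    have := ih (by omega) fun e he => by have := hD e he; omega
    by_cases x ∈ Y <;> by_cases y ∈ Y <;> by_cases y + 1 ∈ Y <;> simp_all <;> omega

lemma IsBipartitionSide.zero_mem_iff (hY : IsBipartitionSide ((cycle n).deleteEdges D) Y)
    (hx : x < n) (hD : ∀ e ∈ D, e < x) : (0 ∈ Y ↔ (x ∈ Y ↔ n % 2 = x % 2)) := by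
  have hlast := hY.mem_iff (adj_cycle_deleteEdges_last (D := D) (by omega) fun h => by
    have := hD _ h; omega)
  have := hY.mem_iff_of_le (by omega : x ≤ n - 1) (by omega) fun e he => .inl (hD e he)
  by_cases x ∈ Y <;> by_cases 0 ∈ Y <;> by_cases n - 1 ∈ Y <;> simp_all <;> omega

lemma cLabel_of_even (hx : x % 2 = 0) : cLabel n x = x / 2 + 1 := by
  rw [cLabel, if_pos (Nat.even_iff.2 hx)]; omega

lemma cLabel_of_odd (hx : x % 2 = 1) : cLabel n x = n - x / 2 := by
  rw [cLabel, if_neg (by rwa [Nat.not_even_iff])]; omega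

lemma bijOn_cLabel : Set.BijOn (cLabel n) (Set.Iio n) (Set.Icc 1 n) := by
  refine ⟨fun x (hx : x < n) => ?_, fun x (hx : x < n) y (hy : y < n) hxy => ?_,
    fun m ⟨hm, hmn⟩ => ?_⟩
  · rcases Nat.mod_two_eq_zero_or_one x with h | h
    · rw [cLabel_of_even h, Set.mem_Icc]; omega
    · rw [cLabel_of_odd h, Set.mem_Icc]; omega
  · rcases Nat.mod_two_eq_zero_or_one x with h | h <;>
      rcases Nat.mod_two_eq_zero_or_one y with h' | h' <;>
      simp only [cLabel_of_even, cLabel_of_odd, h, h'] at hxy <;> omega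
  · by_cases h : 2 * (m - 1) < n
    · exact ⟨2 * (m - 1), h, by rw [cLabel_of_even (by omega)]; omega⟩
    · exact ⟨2 * (n - m) + 1, by rw [Set.mem_Iio]; omega, by rw [cLabel_of_odd (by omega)]; omega⟩

lemma bijOn_cLabel_sub_one (hn : 0 < n) :
    Set.BijOn (fun x => cLabel n x - 1) (Set.Iio n \ {0}) (Set.Icc 1 (n - 1)) := by
  have hsub : Set.BijOn (· - 1) (Set.Icc 1 n \ {1}) (Set.Icc 1 (n - 1)) :=
    ⟨fun x _ => by grind, fun x _ y _ _ => by grind, fun x _ => ⟨x + 1, by grind⟩⟩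
  exact hsub.comp (bijOn_cLabel.sdiff_singleton hn)

lemma bijOn_sub_cLabel (hn : 1 < n) :
    Set.BijOn (fun x => n - cLabel n x) (Set.Iio n \ {1}) (Set.Icc 1 (n - 1)) := by
  have hsub : Set.BijOn (n - ·) (Set.Icc 1 n \ {n}) (Set.Icc 1 (n - 1)) :=
    ⟨fun x _ => by grind, fun x _ y _ _ => by grind, fun x _ => ⟨n - x, by grind⟩⟩
  exact hsub.comp (bijOn_cLabel.sdiff_singleton hn)

/-- For the edge labeling `w`, the induced labels on the `n`-cycle are `a` at the vertices with odd
subscript, `b` at those with even positive subscript, and `c` at `v₀`. -/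
structure HasCornerSums (n : ℕ) (w : ℕ → ℕ) (a b c : ℕ) : Prop where
  of_pos : ∀ x, 0 < x → x < n → vertexLabel (cycle n) w x = if x % 2 = 1 then a else b
  zero : vertexLabel (cycle n) w 0 = c

lemma hasCornerSums_cLabel (hn : 2 ≤ n) :
    HasCornerSums n (cLabel n) (n + 1) (n + 2) (n / 2 + 2) where
  of_pos x hx hxn := by
    rw [vertexLabel_cycle_of_pos hx hxn]
    split_ifs with h
    · rw [cLabel_of_odd h, cLabel_of_even (by omega)]; omega
    · rw [cLabel_of_odd (by omega), cLabel_of_even (by omega)]; omega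
  zero := by
    rw [vertexLabel_cycle_zero hn, cLabel_of_even rfl]
    rcases Nat.mod_two_eq_zero_or_one (n - 1) with h | h
    · rw [cLabel_of_even h]; omega
    · rw [cLabel_of_odd h]; omega

lemma HasCornerSums.sub_one (hw : HasCornerSums n w a b c) (hn : 2 ≤ n) (hpos : ∀ x < n, 1 ≤ w x) :
    HasCornerSums n (fun x => w x - 1) (a - 2) (b - 2) (c - 2) where
  of_pos x hx hxn := by
    have h := hw.of_pos x hx hxn
    rw [vertexLabel_cycle_of_pos hx hxn] at h ⊢
    have := hpos x hxn
    have := hpos (x - 1) (by omega)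
    split_ifs at h ⊢ <;> omega
  zero := by
    have h := hw.zero
    rw [vertexLabel_cycle_zero hn] at h ⊢
    have := hpos 0 (by omega)
    have := hpos (n - 1) (by omega)
    omega

lemma HasCornerSums.const_sub (hw : HasCornerSums n w a b c) (hn : 2 ≤ n) {m : ℕ}
    (hm : ∀ x < n, w x ≤ m) :
    HasCornerSums n (fun x => m - w x) (2 * m - a) (2 * m - b) (2 * m - c) where
  of_pos x hx hxn := by
    have h := hw.of_pos x hx hxn
    rw [vertexLabel_cycle_of_pos hx hxn] at h ⊢
    have := hm x hxn
    have := hm (x - 1) (by omega)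
    split_ifs at h ⊢ <;> omega
  zero := by
    have h := hw.zero
    rw [vertexLabel_cycle_zero hn] at h ⊢
    have := hm 0 (by omega)
    have := hm (n - 1) (by omega)
    omega

lemma exists_hasCornerSums (hn : 6 ≤ n) (hD : D = ∅ ∨ D = {0} ∨ D = {1}) :
    ∃ w a b c, HasCornerSums n w a b c ∧ a ≠ b ∧
      (∀ s ∈ ({c, c + a, c + b, c + a + b} : Set ℕ), s ≠ 2 * a ∧ s ≠ 2 * b) ∧
      (∀ e ∈ D, w e = 0) ∧ Set.BijOn w (Set.Iio n \ D) (Set.Icc 1 (Set.Iio n \ D).ncard) := by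
  have hw := hasCornerSums_cLabel (n := n) (by omega)
  have hmem : ∀ x < n, cLabel n x ∈ Set.Icc 1 n := fun x hx => bijOn_cLabel.mapsTo hx
  have hcard {d : ℕ} (hd : d ∈ Set.Iio n) : (Set.Iio n \ {d}).ncard = n - 1 := by
    rw [Set.ncard_sdiff_singleton_of_mem hd, Set.ncard_Iio_nat]
  rcases hD with rfl | rfl | rfl
  · refine ⟨_, _, _, _, hw, by omega, by simp; omega, by simp, ?_⟩
    rw [Set.sdiff_empty, Set.ncard_Iio_nat]
    exact bijOn_cLabel
  · refine ⟨_, _, _, _, hw.sub_one (by omega) fun x hx => (hmem x hx).1, by omega,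
      by simp; omega, by simp [cLabel], ?_⟩
    rw [hcard (Set.mem_Iio.2 (by omega))]
    exact bijOn_cLabel_sub_one (by omega)
  · refine ⟨_, _, _, _, hw.const_sub (by omega) fun x hx => (hmem x hx).2, by omega,
      by simp; omega, by simp [cLabel], ?_⟩
    rw [hcard (Set.mem_Iio.2 (by omega))]
    exact bijOn_sub_cLabel (by omega)

end Cycle

/-! ### Counting vertices -/

lemma ncard_sep_mem_eq_mul {s : Set α} (hs : s.Finite) {q : α → γ} {X : Set γ} (hX : X.Finite)
    {m : ℕ} (h : ∀ v ∈ X, {x ∈ s | q x = v}.ncard = m) :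
    {x ∈ s | q x ∈ X}.ncard = X.ncard * m := by
  have hunion : {x ∈ s | q x ∈ X} = ⋃ v ∈ X, {x ∈ s | q x = v} := by ext; simp
  have hdisj : X.PairwiseDisjoint fun v => {x ∈ s | q x = v} :=
    (Set.pairwiseDisjoint_fiber q X).mono fun v x hx => hx.2
  rw [hunion, hX.ncard_biUnion (fun v _ => hs.subset (Set.sep_subset _ _)) hdisj,
    finsum_mem_congr rfl h, finsum_mem_eq_finite_toFinset_sum _ hX, Finset.sum_const, smul_eq_mul,
    Set.ncard_eq_toFinset_card _ hX]

lemma ncard_lt_and_mod_two_eq (n : ℕ) {r : ℕ} (hr : r < 2) :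
    {x | x < n ∧ x % 2 = r}.ncard = (n + 1 - r) / 2 := by
  have himage : {x | x < n ∧ x % 2 = r} = (fun i => 2 * i + r) '' Set.Iio ((n + 1 - r) / 2) := by
    ext x
    simp only [Set.mem_ofPred_eq, Set.mem_image, Set.mem_Iio]
    exact ⟨fun hx => ⟨x / 2, by omega⟩, by rintro ⟨i, hi, rfl⟩; omega⟩
  rw [himage, Set.ncard_image_of_injective _ fun i j (h : 2 * i + r = 2 * j + r) => by omega,
    Set.ncard_Iio_nat]

/-! ### Pairings -/

/-- `S` merges the vertices of the block `C ∋ v₀` into one vertex and all other vertices of the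
cycle in pairs of equal parity. No two vertices of `C` are consecutive on the cycle, and apart from
`v₀` they have distinct parities. -/
structure CycleMerging.IsPairing (S : CycleMerging) (C : Finset ℕ) : Prop where
  zero_mem : 0 ∈ C
  coe_mem_blocks : (C : Set ℕ) ∈ S.blocks
  lt_of_mem : ∀ x ∈ C, x < S.n
  succ_notMem : ∀ x ∈ C, x + 1 ∉ C
  last_notMem : S.n - 1 ∉ C
  eq_of_mod_two_eq : ∀ x ∈ C, ∀ y ∈ C, x ≠ 0 → y ≠ 0 → x % 2 = y % 2 → x = y
  pairwiseDisjoint : S.blocks.PairwiseDisjoint id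
  exists_eq_pair : ∀ b ∈ S.blocks, b ≠ C →
    ∃ x y, x < S.n ∧ y < S.n ∧ x ≠ y ∧ x % 2 = y % 2 ∧ b = {x, y}
  exists_mem : ∀ x < S.n, ∃ b ∈ S.blocks, x ∈ b

/-- The vertex of the merged cycle into which `v_x` is merged. -/
def CycleMerging.vertexOf (S : CycleMerging) (x : ℕ) : S.Vertex := Quot.mk _ x

lemma CycleMerging.graph_deleteEdges_eq_map (S : CycleMerging) (D : Set ℕ) :
    S.graph.deleteEdges D = ((cycle S.n).deleteEdges D).map S.vertexOf :=
  map_deleteEdges _ _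

lemma CycleMerging.isConnected_graph_deleteEdges {S : CycleMerging} (hn : 0 < S.n) {D : Set ℕ}
    {d : ℕ} (hD : D ⊆ {d}) : IsConnected (S.graph.deleteEdges D) := by
  rw [CycleMerging.graph_deleteEdges_eq_map]
  exact (isConnected_cycle_deleteEdges hn hD).map _

lemma subset_Iic_one {D : Set ℕ} (hD : D = ∅ ∨ D = {0} ∨ D = {1}) : D ⊆ Set.Iic 1 := by
  rcases hD with rfl | rfl | rfl <;> simp

namespace CycleMerging.IsPairing

variable {S : CycleMerging} {C : Finset ℕ} {D : Set ℕ} {x y a b c : ℕ} {w : ℕ → ℕ}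
  {X : Set S.Vertex}

lemma vertexOf_eq_iff (h : S.IsPairing C) {b : Set ℕ} (hb : b ∈ S.blocks) (hx : x ∈ b) :
    S.vertexOf y = S.vertexOf x ↔ y ∈ b := by
  refine ⟨fun hyx => ?_, fun hy => Quot.sound ⟨b, hb, hy, hx⟩⟩
  have hlift : ∀ u v, (∃ c ∈ S.blocks, u ∈ c ∧ v ∈ c) → (u ∈ b) = (v ∈ b) := by
    rintro u v ⟨c, hc, hu, hv⟩
    refine propext ⟨fun hub => ?_, fun hvb => ?_⟩
    · rwa [h.pairwiseDisjoint.elim_set hb hc u hub hu]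
    · rwa [h.pairwiseDisjoint.elim_set hb hc v hvb hv]
  exact (congrArg (Quot.lift (· ∈ b) hlift) hyx).mpr hx

lemma exists_vertexOf_eq_iff (h : S.IsPairing C) (hx : x < S.n) (hxC : x ∉ C) :
    ∃ y < S.n, y ∉ C ∧ y ≠ x ∧ y % 2 = x % 2 ∧
      ∀ z, S.vertexOf z = S.vertexOf x ↔ z = x ∨ z = y := by
  obtain ⟨b, hb, hxb⟩ := h.exists_mem x hx
  have hbC : b ≠ C := by rintro rfl; exact hxC hxb
  have hdisj : Disjoint b C := h.pairwiseDisjoint hb h.coe_mem_blocks hbC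
  obtain ⟨u, v, hu, hv, huv, hmod, rfl⟩ := h.exists_eq_pair b hb hbC
  have huC : u ∉ C := Set.disjoint_left.1 hdisj (by simp)
  have hvC : v ∉ C := Set.disjoint_left.1 hdisj (by simp)
  rcases hxb with rfl | rfl
  · exact ⟨v, hv, hvC, huv.symm, hmod.symm, fun z => h.vertexOf_eq_iff hb (.inl rfl)⟩
  · exact ⟨u, hu, huC, huv, hmod, fun z => (h.vertexOf_eq_iff hb (.inr rfl)).trans or_comm⟩

lemma vertexOf_eq_zero_iff (h : S.IsPairing C) : S.vertexOf x = S.vertexOf 0 ↔ x ∈ C :=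
  h.vertexOf_eq_iff h.coe_mem_blocks h.zero_mem

lemma fibre_zero (h : S.IsPairing C) : {x ∈ Set.Iio S.n | S.vertexOf x = S.vertexOf 0} = C := by
  ext x; simpa [h.vertexOf_eq_zero_iff] using h.lt_of_mem x

lemma mem_or_mod_two_ne_of_adj (h : S.IsPairing C) (hxy : (cycle S.n).Adj x y) :
    (x ∉ C ∨ y ∉ C) ∧ (x ∈ C ∨ y ∈ C ∨ x % 2 ≠ y % 2) := by
  obtain ⟨e, he⟩ := hxy
  have hzero := h.zero_mem
  have hlast := h.last_notMem
  have hsucc := h.succ_notMem e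
  rcases cycle_isLink_iff.1 he with ⟨-, ⟨rfl, rfl⟩ | ⟨rfl, rfl⟩⟩ | ⟨hn, ⟨rfl, rfl⟩ | ⟨rfl, rfl⟩⟩
  · exact ⟨not_and_or.1 fun hC => hsucc hC.1 hC.2, by omega⟩
  · exact ⟨not_and_or.1 fun hC => hsucc hC.2 hC.1, by omega⟩
  · rw [← hn, Nat.add_sub_cancel] at hlast; exact ⟨.inl hlast, .inr (.inl hzero)⟩
  · rw [← hn, Nat.add_sub_cancel] at hlast; exact ⟨.inr hlast, .inl hzero⟩

lemma vertexOf_ne_of_adj (h : S.IsPairing C) (hxy : (cycle S.n).Adj x y) :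
    S.vertexOf x ≠ S.vertexOf y := by
  intro heq
  obtain ⟨hC, hmod⟩ := h.mem_or_mod_two_ne_of_adj hxy
  have hiff : x ∈ C ↔ y ∈ C := by
    rw [← h.vertexOf_eq_zero_iff, ← h.vertexOf_eq_zero_iff, heq]
  have hyC : y ∉ C := by tauto
  obtain ⟨z, -, -, -, hz, hfib⟩ := h.exists_vertexOf_eq_iff hxy.right_mem hyC
  rcases (hfib x).1 heq with rfl | rfl <;> tauto

lemma vertexLabel_graph (h : S.IsPairing C) (w : ℕ → ℕ) (v : S.Vertex) :
    vertexLabel S.graph w v =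
      ∑ᶠ x ∈ {x ∈ Set.Iio S.n | S.vertexOf x = v}, vertexLabel (cycle S.n) w x :=
  vertexLabel_map (Set.finite_Iio _) (Set.finite_Iio _) (fun _ _ => h.vertexOf_ne_of_adj) v

lemma vertexLabel_graph_of_notMem (h : S.IsPairing C) (hw : HasCornerSums S.n w a b c)
    (hx : x < S.n) (hxC : x ∉ C) :
    vertexLabel S.graph w (S.vertexOf x) = 2 * if x % 2 = 1 then a else b := by
  have hpos : ∀ z, z ∉ C → 0 < z := fun z hz => Nat.pos_of_ne_zero fun h0 => hz (h0 ▸ h.zero_mem)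
  obtain ⟨y, hy, hyC, hyx, hmod, hfib⟩ := h.exists_vertexOf_eq_iff hx hxC
  have hset : {z ∈ Set.Iio S.n | S.vertexOf z = S.vertexOf x} = {x, y} := by
    ext z; simp only [hfib]; grind
  rw [h.vertexLabel_graph, hset, finsum_mem_pair hyx.symm,
    hw.of_pos x (hpos x hxC) hx, hw.of_pos y (hpos y hyC) hy, hmod, two_mul]

lemma vertexLabel_graph_zero_mem (h : S.IsPairing C) (hw : HasCornerSums S.n w a b c) :
    vertexLabel S.graph w (S.vertexOf 0) ∈ ({c, c + a, c + b, c + a + b} : Set ℕ) := by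
  have hsum : vertexLabel S.graph w (S.vertexOf 0) =
      c + ∑ x ∈ C.erase 0, if x % 2 = 1 then a else b := by
    rw [h.vertexLabel_graph, h.fibre_zero, finsum_mem_coe_finset,
      ← Finset.add_sum_erase _ _ h.zero_mem, hw.zero]
    refine congrArg _ (Finset.sum_congr rfl fun x hx => ?_)
    obtain ⟨hx0, hxC⟩ := Finset.mem_erase.1 hx
    exact hw.of_pos x (Nat.pos_of_ne_zero hx0) (h.lt_of_mem x hxC)
  have hodd : ((C.erase 0).filter (· % 2 = 1)).card ≤ 1 := Finset.card_le_one.2 fun x hx y hy => by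
    simp only [Finset.mem_filter, Finset.mem_erase] at hx hy
    exact h.eq_of_mod_two_eq x hx.1.2 y hy.1.2 hx.1.1 hy.1.1 (hx.2.trans hy.2.symm)
  have heven : ((C.erase 0).filter (¬ · % 2 = 1)).card ≤ 1 :=
    Finset.card_le_one.2 fun x hx y hy => by
      simp only [Finset.mem_filter, Finset.mem_erase] at hx hy
      exact h.eq_of_mod_two_eq x hx.1.2 y hy.1.2 hx.1.1 hy.1.1 (by omega)
  rw [hsum, Finset.sum_ite, Finset.sum_const, Finset.sum_const]
  rcases Nat.le_one_iff_eq_zero_or_eq_one.1 hodd with ho | ho <;>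
    rcases Nat.le_one_iff_eq_zero_or_eq_one.1 heven with he | he <;>
    rw [ho, he] <;> simp [add_assoc]

lemma isLocalAntimagic (h : S.IsPairing C) (hw : HasCornerSums S.n w a b c)
    (hab : a ≠ b) (hne : ∀ s ∈ ({c, c + a, c + b, c + a + b} : Set ℕ), s ≠ 2 * a ∧ s ≠ 2 * b)
    (hconn : IsConnected (S.graph.deleteEdges D)) (hwD : ∀ e ∈ D, w e = 0)
    (hbij : Set.BijOn w (Set.Iio S.n \ D) (Set.Icc 1 (Set.Iio S.n \ D).ncard)) :
    IsLocalAntimagic (S.graph.deleteEdges D) w := by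
  refine ⟨hconn, hbij, fun u v huv => ?_⟩
  rw [vertexLabel_deleteEdges hwD, vertexLabel_deleteEdges hwD]
  rw [graph_deleteEdges_eq_map] at huv
  obtain ⟨e, x, y, ⟨hxy, -⟩, rfl, rfl⟩ := huv
  have hx := h.vertexLabel_graph_of_notMem hw hxy.left_mem
  have hy := h.vertexLabel_graph_of_notMem hw hxy.right_mem
  obtain ⟨hne₁, hne₂⟩ := hne _ (h.vertexLabel_graph_zero_mem hw)
  obtain ⟨hC, hmod⟩ := h.mem_or_mod_two_ne_of_adj ⟨e, hxy⟩
  by_cases hxC : x ∈ C <;> by_cases hyC : y ∈ C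
  · tauto
  · rw [h.vertexOf_eq_zero_iff.2 hxC, hy hyC]; split_ifs <;> assumption
  · rw [h.vertexOf_eq_zero_iff.2 hyC, hx hxC]; split_ifs <;> exact Ne.symm ‹_›
  · rw [hx hxC, hy hyC]; grind

lemma colorNumber_graph_deleteEdges_le_three (h : S.IsPairing C) (hw : HasCornerSums S.n w a b c)
    (hwD : ∀ e ∈ D, w e = 0) : colorNumber (S.graph.deleteEdges D) w ≤ 3 := by
  have hsub : vertexLabel (S.graph.deleteEdges D) w '' V(S.graph.deleteEdges D) ⊆
      ({2 * a, 2 * b, vertexLabel S.graph w (S.vertexOf 0)} : Finset ℕ) := by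
    rw [graph_deleteEdges_eq_map]
    rintro _ ⟨_, ⟨x, hx, rfl⟩, rfl⟩
    rw [← graph_deleteEdges_eq_map, vertexLabel_deleteEdges hwD]
    by_cases hxC : x ∈ C
    · simp [h.vertexOf_eq_zero_iff.2 hxC]
    · rw [h.vertexLabel_graph_of_notMem hw hx hxC]; split_ifs <;> simp
  refine (Set.encard_le_encard hsub).trans ?_
  rw [Set.encard_coe_eq_coe_finsetCard]
  exact_mod_cast Finset.card_le_three

lemma chiLa_graph_deleteEdges_le_three (h : S.IsPairing C) (hn : 6 ≤ S.n)
    (hD : D = ∅ ∨ D = {0} ∨ D = {1}) : chiLa (S.graph.deleteEdges D) ≤ 3 := by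
  have hconn : IsConnected (S.graph.deleteEdges D) := by
    rcases hD with rfl | rfl | rfl
    exacts [isConnected_graph_deleteEdges (by omega) (Set.empty_subset {0}),
      isConnected_graph_deleteEdges (by omega) subset_rfl,
      isConnected_graph_deleteEdges (by omega) subset_rfl]
  obtain ⟨w, a, b, c, hw, hab, hne, hwD, hbij⟩ := exists_hasCornerSums hn hD
  exact (iInf₂_le w (h.isLocalAntimagic hw hab hne hconn hwD hbij)).trans
    (h.colorNumber_graph_deleteEdges_le_three hw hwD)

/-! ### Three colors are necessary -/

lemma ncard_preimage_vertexOf (h : S.IsPairing C) (hX : X ⊆ V(S.graph))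
    (hX₀ : S.vertexOf 0 ∈ X → C.card = 2) :
    {x ∈ Set.Iio S.n | S.vertexOf x ∈ X}.ncard = X.ncard * 2 := by
  refine ncard_sep_mem_eq_mul (Set.finite_Iio _) (((Set.finite_Iio _).image _).subset hX) ?_
  intro v hv
  obtain ⟨x, hx, rfl⟩ : ∃ x < S.n, S.vertexOf x = v := hX hv
  by_cases hxC : x ∈ C
  · rw [h.vertexOf_eq_zero_iff.2 hxC] at hv ⊢
    rw [h.fibre_zero, Set.ncard_coe_finset, hX₀ hv]
  · obtain ⟨y, hy, -, hyx, -, hfib⟩ := h.exists_vertexOf_eq_iff hx hxC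
    rw [← Set.ncard_pair hyx.symm]
    congr 1
    ext z; simp only [hfib]; grind

lemma isBipartitionSide_preimage_vertexOf (hX : IsBipartitionSide (S.graph.deleteEdges D) X) :
    IsBipartitionSide ((cycle S.n).deleteEdges D) {x ∈ Set.Iio S.n | S.vertexOf x ∈ X} := by
  rw [graph_deleteEdges_eq_map] at hX
  exact hX.preimage

lemma mem_preimage_vertexOf (hx : x < S.n) :
    x ∈ {z ∈ Set.Iio S.n | S.vertexOf z ∈ X} ↔ S.vertexOf x ∈ X :=
  and_iff_right hx

lemma three_le_chiLa_of_mem (h : S.IsPairing C) (hD : D ⊆ Set.Iic 1) (hx : x ∈ C) (hx₂ : 2 ≤ x)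
    (hmod : x % 2 ≠ S.n % 2) : 3 ≤ chiLa (S.graph.deleteEdges D) := by
  refine three_le_chiLa_of_forall_not_isBipartitionSide fun X hX => ?_
  have hxn := h.lt_of_mem x hx
  have hpath := (isBipartitionSide_preimage_vertexOf hX).zero_mem_iff hxn
    fun e he => (hD he).trans_lt hx₂
  rw [mem_preimage_vertexOf hxn, mem_preimage_vertexOf (by omega),
    h.vertexOf_eq_zero_iff.2 hx] at hpath
  tauto

lemma one_mem_iff_of_isBipartitionSide (h : S.IsPairing C) (hn : 2 ≤ S.n) (hD : D ⊆ Set.Iic 1)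
    (hX : IsBipartitionSide (S.graph.deleteEdges D) X) :
    (S.vertexOf 1 ∈ X ↔ (S.vertexOf 0 ∈ X ↔ S.n % 2 = 1)) := by
  obtain ⟨y, hy, -, hy1, hmod, hfib⟩ :=
    h.exists_vertexOf_eq_iff (x := 1) (by omega) (h.succ_notMem 0 h.zero_mem)
  have hpath := (isBipartitionSide_preimage_vertexOf hX).zero_mem_iff hy
    fun e he => (hD he).trans_lt (by omega)
  rw [mem_preimage_vertexOf hy, mem_preimage_vertexOf (by omega), (hfib y).2 (.inr rfl),
    hmod] at hpath
  tauto

lemma three_le_chiLa_of_odd (h : S.IsPairing C) (hn : 2 ≤ S.n) (hodd : S.n % 2 = 1)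
    (hD : D ⊆ {1}) : 3 ≤ chiLa (S.graph.deleteEdges D) := by
  refine three_le_chiLa_of_forall_not_isBipartitionSide fun X hX => ?_
  have hone := h.one_mem_iff_of_isBipartitionSide hn (fun e he => (hD he).le) hX
  have hedge := (isBipartitionSide_preimage_vertexOf hX).mem_iff
    (adj_cycle_deleteEdges_succ (x := 0) (by omega) fun h => zero_ne_one (hD h))
  rw [mem_preimage_vertexOf (by omega), mem_preimage_vertexOf (by omega), zero_add] at hedge
  tauto

lemma mem_iff_mod_two_eq_of_isBipartitionSide (h : S.IsPairing C) (hn : 4 ≤ S.n)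
    (heven : S.n % 2 = 0) (hD : D ⊆ Set.Iic 1) (hy : y ∈ C) (hy₂ : 2 ≤ y) (hymod : y % 2 = 0)
    (hX : IsBipartitionSide (S.graph.deleteEdges D) X) (hx : x < S.n) :
    (S.vertexOf x ∈ X ↔ (S.vertexOf 0 ∈ X ↔ x % 2 = 0)) := by
  have hyn := h.lt_of_mem y hy
  have hone := h.one_mem_iff_of_isBipartitionSide (by omega) hD hX
  have htwo {z : ℕ} (hz : 2 ≤ z) (hzn : z < S.n) :
      (S.vertexOf z ∈ X ↔ (S.vertexOf 2 ∈ X ↔ z % 2 = 0)) := by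
    have hpath := (isBipartitionSide_preimage_vertexOf hX).mem_iff_of_le hz hzn
      fun e he => .inl ((hD he).trans_lt (by omega))
    rwa [mem_preimage_vertexOf hzn, mem_preimage_vertexOf (by omega)] at hpath
  have hzero := htwo hy₂ hyn
  rw [h.vertexOf_eq_zero_iff.2 hy] at hzero
  obtain rfl | rfl | hx₂ : x = 0 ∨ x = 1 ∨ 2 ≤ x := by omega
  · simp
  · rw [hone]; simp [heven]
  · rw [htwo hx₂ hx, hzero]; simp [hymod]

lemma three_le_chiLa_of_pair (h : S.IsPairing {0, y}) (hy : y ≠ 0) (hn : 4 ≤ S.n)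
    (heven : S.n % 2 = 0) (hD : D ⊆ Set.Iic 1) : 3 ≤ chiLa (S.graph.deleteEdges D) := by
  have hyC : y ∈ ({0, y} : Finset ℕ) := by simp
  have hy₂ : 2 ≤ y := by
    have := h.succ_notMem 0 h.zero_mem
    grind
  by_cases hymod : y % 2 = 0
  swap; · exact h.three_le_chiLa_of_mem hD hyC hy₂ (by omega)
  have hadj : (S.graph.deleteEdges D).Adj (S.vertexOf 2) (S.vertexOf 3) := by
    rw [graph_deleteEdges_eq_map]
    exact (adj_cycle_deleteEdges_succ (by omega) fun h2 => by simpa using hD h2).map _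
  refine three_le_chiLa_of_ncard_eq ((Set.finite_Iio _).image _) hadj (m := S.n / 2 / 2) ?_
  intro X hX
  have hcard := h.ncard_preimage_vertexOf hX.subset fun _ => Finset.card_pair hy.symm
  have hmem {x : ℕ} (hx : x < S.n) :=
    h.mem_iff_mod_two_eq_of_isBipartitionSide hn heven hD hyC hy₂ hymod hX hx
  obtain ⟨r, hr, hset⟩ : ∃ r < 2,
      {x ∈ Set.Iio S.n | S.vertexOf x ∈ X} = {x | x < S.n ∧ x % 2 = r} := by
    by_cases h0 : S.vertexOf 0 ∈ X
    · exact ⟨0, by omega, Set.ext fun x => and_congr_right fun hx => by simp [hmem hx, h0]⟩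
    · exact ⟨1, by omega, Set.ext fun x => and_congr_right fun hx => by simp [hmem hx, h0]⟩
  rw [hset, ncard_lt_and_mod_two_eq _ hr] at hcard
  omega

lemma incidenceSet_graph_deleteEdges_zero (h : S.IsPairing {0}) (hn : 2 ≤ S.n) :
    (S.graph.deleteEdges {0}).incidenceSet (S.vertexOf 0) = {S.n - 1} := by
  rw [graph_deleteEdges_eq_map]
  ext e
  simp only [Graph.mem_incidenceSet, Graph.map_inc, Graph.deleteEdges_inc, cycle_inc_iff]
  have hv (x) : S.vertexOf 0 = S.vertexOf x ↔ x = 0 := by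
    rw [eq_comm, h.vertexOf_eq_zero_iff, Finset.mem_singleton]
  simp only [hv, Set.mem_singleton_iff]
  constructor
  · rintro ⟨x, h, rfl⟩; omega
  · rintro rfl; exact ⟨0, by omega, rfl⟩

lemma two_mul_ncard_le_of_isBipartitionSide (h : S.IsPairing {0}) (hn : 5 ≤ S.n)
    (hodd : S.n % 2 = 1) (hX : IsBipartitionSide (S.graph.deleteEdges {0}) X)
    (h0 : S.vertexOf 0 ∈ X) : 2 * X.ncard ≤ S.n - 1 := by
  have hX' : (X \ {S.vertexOf 0}).ncard + 1 = X.ncard :=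
    Set.ncard_sdiff_singleton_add_one h0 (((Set.finite_Iio _).image _).subset hX.subset)
  have hpre := h.ncard_preimage_vertexOf (X := X \ {S.vertexOf 0})
    (Set.sdiff_subset.trans hX.subset) fun hmem => absurd rfl hmem.2
  have hsub : {x ∈ Set.Iio S.n | S.vertexOf x ∈ X \ {S.vertexOf 0}} ⊆
      {x | x < S.n ∧ x % 2 = 1} := by
    rintro x ⟨hx, hxX, hx0⟩
    have hxpos : x ≠ 0 := by rintro rfl; exact hx0 rfl
    have hpath := (isBipartitionSide_preimage_vertexOf hX).zero_mem_iff hx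
      fun e (he : e = 0) => by omega
    rw [mem_preimage_vertexOf hx, mem_preimage_vertexOf (by omega)] at hpath
    exact ⟨hx, by have := (hpath.1 h0).1 hxX; omega⟩
  have hle := Set.ncard_le_ncard hsub ((Set.finite_Iio S.n).subset fun x hx => hx.1)
  rw [hpre, ncard_lt_and_mod_two_eq _ (by omega)] at hle
  omega

lemma three_le_chiLa_deleteEdges_zero (h : S.IsPairing {0}) (hn : 5 ≤ S.n)
    (hodd : S.n % 2 = 1) : 3 ≤ chiLa (S.graph.deleteEdges {0}) := by
  have hcard : E(S.graph.deleteEdges {0}).ncard = S.n - 1 := by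
    change (Set.Iio S.n \ {0}).ncard = _
    rw [Set.ncard_sdiff_singleton_of_mem (Set.mem_Iio.2 (by omega)), Set.ncard_Iio_nat]
  exact three_le_chiLa_of_incidenceSet_eq_singleton ((Set.finite_Iio _).image _)
    ⟨0, Set.mem_Iio.2 (by omega), rfl⟩ (h.incidenceSet_graph_deleteEdges_zero (by omega))
    fun X hX h0 => hcard ▸ h.two_mul_ncard_le_of_isBipartitionSide hn hodd hX h0

section

variable (hn : 6 ≤ S.n) (hD : D = ∅ ∨ D = {0} ∨ D = {1})
include hn hD

lemma chiLa_eq_three_of_mem (h : S.IsPairing C) (hx : x ∈ C) (hx₂ : 2 ≤ x)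
    (hmod : x % 2 ≠ S.n % 2) : chiLa (S.graph.deleteEdges D) = 3 :=
  (h.chiLa_graph_deleteEdges_le_three hn hD).antisymm
    (h.three_le_chiLa_of_mem (subset_Iic_one hD) hx hx₂ hmod)

lemma chiLa_eq_three_of_pair (h : S.IsPairing {0, y}) (hy : y ≠ 0) (heven : S.n % 2 = 0) :
    chiLa (S.graph.deleteEdges D) = 3 :=
  (h.chiLa_graph_deleteEdges_le_three hn hD).antisymm
    (h.three_le_chiLa_of_pair hy (by omega) heven (subset_Iic_one hD))

lemma chiLa_eq_three_of_singleton (h : S.IsPairing {0}) (hodd : S.n % 2 = 1) :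
    chiLa (S.graph.deleteEdges D) = 3 := by
  refine (h.chiLa_graph_deleteEdges_le_three hn hD).antisymm ?_
  rcases hD with rfl | rfl | rfl
  · exact h.three_le_chiLa_of_odd (by omega) hodd (Set.empty_subset _)
  · exact h.three_le_chiLa_deleteEdges_zero (by omega) hodd
  · exact h.three_le_chiLa_of_odd (by omega) hodd subset_rfl

end

end CycleMerging.IsPairing

/-! ### The seven families -/

lemma pairwiseDisjoint_id_of_forall_subset {B : Set (Set α)}
    (h : ∀ b ∈ B, ∀ b' ∈ B, ∀ x ∈ b, x ∈ b' → b ⊆ b') : B.PairwiseDisjoint id :=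
  fun b hb b' hb' hne => Set.disjoint_left.2 fun x hx hx' =>
    hne ((h b hb b' hb' x hx hx').antisymm (h b' hb' b hb x hx' hx))

variable {k : ℕ}

lemma isPairing_G0Two : (G0Two k).IsPairing {0, 4 * k + 2} where
  zero_mem := by simp
  coe_mem_blocks := .inl ⟨0, by simp⟩
  lt_of_mem := by grind [G0Two]
  succ_notMem := by grind
  last_notMem := by grind [G0Two]
  eq_of_mod_two_eq := by grind
  pairwiseDisjoint := by
    apply pairwiseDisjoint_id_of_forall_subset
    rintro b (⟨i, hi, rfl⟩ | ⟨i, hi, rfl⟩ | ⟨i, hi, rfl⟩)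
      b' (⟨j, hj, rfl⟩ | ⟨j, hj, rfl⟩ | ⟨j, hj, rfl⟩)
      x hx hx' y hy <;>
    simp only [Set.mem_insert_iff, Set.mem_singleton_iff] at hx hx' hy ⊢ <;> omega
  exists_eq_pair := by
    rintro b (⟨i, hi, rfl⟩ | ⟨i, hi, rfl⟩ | ⟨i, hi, rfl⟩) -
    all_goals exact ⟨_, _, by grind [G0Two], by grind [G0Two], by omega, by omega, rfl⟩
  exists_mem x hx := by
    change x < 8 * k + 4 at hx
    obtain h | h | h | h | h | h :
        (x % 2 = 0 ∧ x < 4 * k + 2) ∨ (x % 2 = 0 ∧ 4 * k + 2 ≤ x) ∨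
        (x % 2 = 1 ∧ x < 2 * k + 3) ∨ (x % 2 = 1 ∧ 2 * k + 3 ≤ x ∧ x < 4 * k + 5) ∨
        (x % 2 = 1 ∧ 4 * k + 5 ≤ x ∧ x < 6 * k + 5) ∨ (x % 2 = 1 ∧ 6 * k + 5 ≤ x) := by omega
    · exact ⟨_, .inl ⟨x / 2, by omega, rfl⟩, by grind⟩
    · exact ⟨_, .inl ⟨(x - (4 * k + 2)) / 2, by omega, rfl⟩, by grind⟩
    · exact ⟨_, .inr (.inl ⟨x / 2, by omega, rfl⟩), by grind⟩
    · exact ⟨_, .inr (.inl ⟨(x - (2 * k + 3)) / 2, by omega, rfl⟩), by grind⟩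
    · exact ⟨_, .inr (.inr ⟨(x - (4 * k + 5)) / 2, by omega, rfl⟩), by grind⟩
    · exact ⟨_, .inr (.inr ⟨(x - (6 * k + 5)) / 2, by omega, rfl⟩), by grind⟩

lemma isPairing_G1One (hk : 1 ≤ k) : (G1One k).IsPairing {0, 4 * k + 1} where
  zero_mem := by simp
  coe_mem_blocks := .inr (by simp)
  lt_of_mem := by grind [G1One]
  succ_notMem := by grind
  last_notMem := by grind [G1One]
  eq_of_mod_two_eq := by grind
  pairwiseDisjoint := by
    apply pairwiseDisjoint_id_of_forall_subset
    rintro b ((⟨i, hi, hi', rfl⟩ | ⟨i, hi, rfl⟩) | rfl)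
      b' ((⟨j, hj, hj', rfl⟩ | ⟨j, hj, rfl⟩) | rfl)
      x hx hx' y hy <;>
    simp only [Set.mem_insert_iff, Set.mem_singleton_iff] at hx hx' hy ⊢ <;> omega
  exists_eq_pair := by
    rintro b ((⟨i, -, hi, rfl⟩ | ⟨i, hi, rfl⟩) | rfl) hb
    case inr => simp at hb
    all_goals exact ⟨_, _, by grind [G1One], by grind [G1One], by omega, by omega, rfl⟩
  exists_mem x hx := by
    change x < 8 * k + 2 at hx
    obtain h | h | h | h | h :
        (x = 0 ∨ x = 4 * k + 1) ∨ (x % 2 = 0 ∧ 0 < x ∧ x ≤ 4 * k) ∨ (x % 2 = 0 ∧ 4 * k < x) ∨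
        (x % 2 = 1 ∧ x < 4 * k) ∨ (x % 2 = 1 ∧ 4 * k + 3 ≤ x) := by omega
    · exact ⟨_, .inr rfl, by grind⟩
    · exact ⟨_, .inl (.inl ⟨x / 2, by omega, by omega, rfl⟩), by grind⟩
    · exact ⟨_, .inl (.inl ⟨(x - 4 * k) / 2, by omega, by omega, rfl⟩), by grind⟩
    · exact ⟨_, .inl (.inr ⟨x / 2, by omega, rfl⟩), by grind⟩
    · exact ⟨_, .inl (.inr ⟨(x - (4 * k + 3)) / 2, by omega, rfl⟩), by grind⟩

lemma isPairing_G1Three : (G1Three k).IsPairing {0, 4 * k + 3} where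
  zero_mem := by simp
  coe_mem_blocks := .inr (by simp)
  lt_of_mem := by grind [G1Three]
  succ_notMem := by grind
  last_notMem := by grind [G1Three]
  eq_of_mod_two_eq := by grind
  pairwiseDisjoint := by
    apply pairwiseDisjoint_id_of_forall_subset
    rintro b ((⟨i, hi, hi', rfl⟩ | ⟨i, hi, rfl⟩ | ⟨i, hi, rfl⟩) | rfl)
      b' ((⟨j, hj, hj', rfl⟩ | ⟨j, hj, rfl⟩ | ⟨j, hj, rfl⟩) | rfl)
      x hx hx' y hy <;>
    simp only [Set.mem_insert_iff, Set.mem_singleton_iff] at hx hx' hy ⊢ <;> omega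
  exists_eq_pair := by
    rintro b ((⟨i, -, hi, rfl⟩ | ⟨i, hi, rfl⟩ | ⟨i, hi, rfl⟩) | rfl) hb
    case inr => simp at hb
    all_goals exact ⟨_, _, by grind [G1Three], by grind [G1Three], by omega, by omega, rfl⟩
  exists_mem x hx := by
    change x < 8 * k + 6 at hx
    obtain h | h | h | h | h | h | h :
        (x = 0 ∨ x = 4 * k + 3) ∨ (x % 2 = 0 ∧ 0 < x ∧ x ≤ 4 * k + 2) ∨
        (x % 2 = 0 ∧ 4 * k + 2 < x) ∨ (x % 2 = 1 ∧ x < 2 * k + 3) ∨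
        (x % 2 = 1 ∧ 2 * k + 3 ≤ x ∧ x < 4 * k + 3) ∨
        (x % 2 = 1 ∧ 4 * k + 5 ≤ x ∧ x < 6 * k + 5) ∨ (x % 2 = 1 ∧ 6 * k + 5 ≤ x) := by omega
    · exact ⟨_, .inr rfl, by grind⟩
    · exact ⟨_, .inl (.inl ⟨x / 2, by omega, by omega, rfl⟩), by grind⟩
    · exact ⟨_, .inl (.inl ⟨(x - (4 * k + 2)) / 2, by omega, by omega, rfl⟩), by grind⟩
    · exact ⟨_, .inl (.inr (.inl ⟨x / 2, by omega, rfl⟩)), by grind⟩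
    · exact ⟨_, .inl (.inr (.inr ⟨(x - (2 * k + 3)) / 2, by omega, rfl⟩)), by grind⟩
    · exact ⟨_, .inl (.inr (.inr ⟨(x - (4 * k + 5)) / 2, by omega, rfl⟩)), by grind⟩
    · exact ⟨_, .inl (.inr (.inl ⟨(x - (6 * k + 5)) / 2, by omega, rfl⟩)), by grind⟩

lemma isPairing_G2One (hk : 1 ≤ k) : (G2One k).IsPairing {0} where
  zero_mem := by simp
  coe_mem_blocks := .inr (by simp)
  lt_of_mem := by grind [G2One]
  succ_notMem := by grind
  last_notMem := by grind [G2One]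
  eq_of_mod_two_eq := by grind
  pairwiseDisjoint := by
    apply pairwiseDisjoint_id_of_forall_subset
    rintro b ((⟨i, hi, hi', rfl⟩ | ⟨i, hi, rfl⟩ | ⟨i, hi, rfl⟩) | rfl)
      b' ((⟨j, hj, hj', rfl⟩ | ⟨j, hj, rfl⟩ | ⟨j, hj, rfl⟩) | rfl)
      x hx hx' y hy <;>
    simp only [Set.mem_insert_iff, Set.mem_singleton_iff] at hx hx' hy ⊢ <;> omega
  exists_eq_pair := by
    rintro b ((⟨i, -, hi, rfl⟩ | ⟨i, hi, rfl⟩ | ⟨i, hi, rfl⟩) | rfl) hb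
    case inr => simp at hb
    all_goals exact ⟨_, _, by grind [G2One], by grind [G2One], by omega, by omega, rfl⟩
  exists_mem x hx := by
    change x < 8 * k + 1 at hx
    obtain h | h | h | h | h | h | h :
        x = 0 ∨ (x % 2 = 0 ∧ 0 < x ∧ x ≤ 4 * k) ∨ (x % 2 = 0 ∧ 4 * k < x) ∨
        (x % 2 = 1 ∧ x < 2 * k + 1) ∨ (x % 2 = 1 ∧ 2 * k + 1 ≤ x ∧ x < 4 * k + 1) ∨
        (x % 2 = 1 ∧ 4 * k + 1 ≤ x ∧ x < 6 * k + 1) ∨ (x % 2 = 1 ∧ 6 * k + 1 ≤ x) := by omega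
    · exact ⟨_, .inr rfl, by grind⟩
    · exact ⟨_, .inl (.inl ⟨x / 2, by omega, by omega, rfl⟩), by grind⟩
    · exact ⟨_, .inl (.inl ⟨(x - 4 * k) / 2, by omega, by omega, rfl⟩), by grind⟩
    · exact ⟨_, .inl (.inr (.inl ⟨x / 2, by omega, rfl⟩)), by grind⟩
    · exact ⟨_, .inl (.inr (.inl ⟨(x - (2 * k + 1)) / 2, by omega, rfl⟩)), by grind⟩
    · exact ⟨_, .inl (.inr (.inr ⟨(x - (4 * k + 1)) / 2, by omega, rfl⟩)), by grind⟩
    · exact ⟨_, .inl (.inr (.inr ⟨(x - (6 * k + 1)) / 2, by omega, rfl⟩)), by grind⟩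

lemma isPairing_G2Three : (G2Three k).IsPairing {0} where
  zero_mem := by simp
  coe_mem_blocks := .inr (by simp)
  lt_of_mem := by grind [G2Three]
  succ_notMem := by grind
  last_notMem := by grind [G2Three]
  eq_of_mod_two_eq := by grind
  pairwiseDisjoint := by
    apply pairwiseDisjoint_id_of_forall_subset
    rintro b ((⟨i, hi, hi', rfl⟩ | ⟨i, hi, rfl⟩ | ⟨i, hi, rfl⟩) | rfl)
      b' ((⟨j, hj, hj', rfl⟩ | ⟨j, hj, rfl⟩ | ⟨j, hj, rfl⟩) | rfl)
      x hx hx' y hy <;>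
    simp only [Set.mem_insert_iff, Set.mem_singleton_iff] at hx hx' hy ⊢ <;> omega
  exists_eq_pair := by
    rintro b ((⟨i, -, hi, rfl⟩ | ⟨i, hi, rfl⟩ | ⟨i, hi, rfl⟩) | rfl) hb
    case inr => simp at hb
    all_goals exact ⟨_, _, by grind [G2Three], by grind [G2Three], by omega, by omega, rfl⟩
  exists_mem x hx := by
    change x < 8 * k + 5 at hx
    obtain h | h | h | h | h | h | h :
        x = 0 ∨ (x % 2 = 0 ∧ 0 < x ∧ x ≤ 4 * k + 2) ∨ (x % 2 = 0 ∧ 4 * k + 2 < x) ∨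
        (x % 2 = 1 ∧ x < 2 * k + 3) ∨ (x % 2 = 1 ∧ 2 * k + 3 ≤ x ∧ x < 4 * k + 3) ∨
        (x % 2 = 1 ∧ 4 * k + 3 ≤ x ∧ x < 6 * k + 3) ∨ (x % 2 = 1 ∧ 6 * k + 3 ≤ x) := by omega
    · exact ⟨_, .inr rfl, by grind⟩
    · exact ⟨_, .inl (.inl ⟨x / 2, by omega, by omega, rfl⟩), by grind⟩
    · exact ⟨_, .inl (.inl ⟨(x - (4 * k + 2)) / 2, by omega, by omega, rfl⟩), by grind⟩
    · exact ⟨_, .inl (.inr (.inl ⟨x / 2, by omega, rfl⟩)), by grind⟩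
    · exact ⟨_, .inl (.inr (.inr ⟨(x - (2 * k + 3)) / 2, by omega, rfl⟩)), by grind⟩
    · exact ⟨_, .inl (.inr (.inr ⟨(x - (4 * k + 3)) / 2, by omega, rfl⟩)), by grind⟩
    · exact ⟨_, .inl (.inr (.inl ⟨(x - (6 * k + 3)) / 2, by omega, rfl⟩)), by grind⟩

lemma isPairing_G3One (hk : 1 ≤ k) : (G3One k).IsPairing {0, 2 * k + 1, 6 * k + 2} where
  zero_mem := by simp
  coe_mem_blocks := .inr (by simp)
  lt_of_mem := by grind [G3One]
  succ_notMem := by grind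
  last_notMem := by grind [G3One]
  eq_of_mod_two_eq := by grind
  pairwiseDisjoint := by
    apply pairwiseDisjoint_id_of_forall_subset
    rintro b (((⟨i, hi, hi', rfl⟩ | ⟨i, hi, hi', rfl⟩) | ⟨i, hi, rfl⟩ | ⟨i, hi, rfl⟩) | rfl)
      b' (((⟨j, hj, hj', rfl⟩ | ⟨j, hj, hj', rfl⟩) | ⟨j, hj, rfl⟩ | ⟨j, hj, rfl⟩) | rfl)
      x hx hx' y hy <;>
    simp only [Set.mem_insert_iff, Set.mem_singleton_iff] at hx hx' hy ⊢ <;> omega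
  exists_eq_pair := by
    rintro b (((⟨i, -, hi, rfl⟩ | ⟨i, -, hi, rfl⟩) | ⟨i, hi, rfl⟩ | ⟨i, hi, rfl⟩) | rfl) hb
    case inr => simp at hb
    all_goals exact ⟨_, _, by grind [G3One], by grind [G3One], by omega, by omega, rfl⟩
  exists_mem x hx := by
    change x < 8 * k + 3 at hx
    obtain h | h | h | h | h | h | h | h | h :
        (x = 0 ∨ x = 2 * k + 1 ∨ x = 6 * k + 2) ∨ (x % 2 = 0 ∧ 0 < x ∧ x ≤ 2 * k) ∨
        (x % 2 = 0 ∧ 2 * k < x ∧ x ≤ 4 * k) ∨ (x % 2 = 0 ∧ 4 * k < x ∧ x ≤ 6 * k) ∨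
        (x % 2 = 0 ∧ 6 * k + 2 < x) ∨ (x % 2 = 1 ∧ x < 2 * k + 1) ∨
        (x % 2 = 1 ∧ 2 * k + 3 ≤ x ∧ x < 4 * k + 3) ∨
        (x % 2 = 1 ∧ 4 * k + 3 ≤ x ∧ x < 6 * k + 3) ∨ (x % 2 = 1 ∧ 6 * k + 3 ≤ x) := by omega
    · exact ⟨_, .inr rfl, by grind⟩
    · exact ⟨_, .inl (.inl (.inl ⟨x / 2, by omega, by omega, rfl⟩)), by grind⟩
    · exact ⟨_, .inl (.inl (.inr ⟨(x - 2 * k) / 2, by omega, by omega, rfl⟩)), by grind⟩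
    · exact ⟨_, .inl (.inl (.inl ⟨(x - 4 * k) / 2, by omega, by omega, rfl⟩)), by grind⟩
    · exact ⟨_, .inl (.inl (.inr ⟨(x - (6 * k + 2)) / 2, by omega, by omega, rfl⟩)), by grind⟩
    · exact ⟨_, .inl (.inr (.inl ⟨x / 2, by omega, rfl⟩)), by grind⟩
    · exact ⟨_, .inl (.inr (.inr ⟨(x - (2 * k + 3)) / 2, by omega, rfl⟩)), by grind⟩
    · exact ⟨_, .inl (.inr (.inr ⟨(x - (4 * k + 3)) / 2, by omega, rfl⟩)), by grind⟩
    · exact ⟨_, .inl (.inr (.inl ⟨(8 * k + 1 - x) / 2, by omega, rfl⟩)), by grind⟩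

lemma isPairing_G3Three : (G3Three k).IsPairing {0, 2 * k + 2, 6 * k + 5} where
  zero_mem := by simp
  coe_mem_blocks := .inr (by simp)
  lt_of_mem := by grind [G3Three]
  succ_notMem := by grind
  last_notMem := by grind [G3Three]
  eq_of_mod_two_eq := by grind
  pairwiseDisjoint := by
    apply pairwiseDisjoint_id_of_forall_subset
    rintro b (((⟨i, hi, hi', rfl⟩ | ⟨i, hi, hi', rfl⟩) | ⟨i, hi, rfl⟩ | ⟨i, hi, rfl⟩) | rfl)
      b' (((⟨j, hj, hj', rfl⟩ | ⟨j, hj, hj', rfl⟩) | ⟨j, hj, rfl⟩ | ⟨j, hj, rfl⟩) | rfl)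
      x hx hx' y hy <;>
    simp only [Set.mem_insert_iff, Set.mem_singleton_iff] at hx hx' hy ⊢ <;> omega
  exists_eq_pair := by
    rintro b (((⟨i, hi, hi', rfl⟩ | ⟨i, hi, hi', rfl⟩) | ⟨i, hi, rfl⟩ | ⟨i, hi, rfl⟩) | rfl) hb
    case inr => simp at hb
    all_goals exact ⟨_, _, by grind [G3Three], by grind [G3Three], by omega, by omega, rfl⟩
  exists_mem x hx := by
    change x < 8 * k + 7 at hx
    obtain h | h | h | h | h | h | h | h | h :
        (x = 0 ∨ x = 2 * k + 2 ∨ x = 6 * k + 5) ∨ (x % 2 = 0 ∧ 0 < x ∧ x ≤ 2 * k) ∨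
        (x % 2 = 0 ∧ 2 * k + 2 < x ∧ x ≤ 4 * k + 4) ∨
        (x % 2 = 0 ∧ 4 * k + 4 < x ∧ x ≤ 6 * k + 4) ∨ (x % 2 = 0 ∧ 6 * k + 4 < x) ∨
        (x % 4 = 1 ∧ x < 4 * k + 3) ∨ (x % 4 = 3 ∧ x < 4 * k + 3) ∨
        (x % 2 = 1 ∧ 4 * k + 3 ≤ x ∧ x < 6 * k + 5) ∨ (x % 2 = 1 ∧ 6 * k + 7 ≤ x) := by omega
    · exact ⟨_, .inr rfl, by grind⟩
    · exact ⟨_, .inl (.inl (.inl ⟨x / 2, by omega, by omega, rfl⟩)), by grind⟩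
    · exact ⟨_, .inl (.inl (.inr ⟨(x - (2 * k + 2)) / 2, by omega, by omega, rfl⟩)), by grind⟩
    · exact ⟨_, .inl (.inl (.inl ⟨(x - (4 * k + 4)) / 2, by omega, by omega, rfl⟩)), by grind⟩
    · exact ⟨_, .inl (.inl (.inr ⟨(x - (6 * k + 4)) / 2, by omega, by omega, rfl⟩)), by grind⟩
    · exact ⟨_, .inl (.inr (.inl ⟨x / 4, by omega, rfl⟩)), by grind⟩
    · exact ⟨_, .inl (.inr (.inr ⟨x / 4, by omega, rfl⟩)), by grind⟩
    · exact ⟨_, .inl (.inr (.inl ⟨(x - (4 * k + 3)) / 2, by omega, rfl⟩)), by grind⟩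
    · exact ⟨_, .inl (.inr (.inr ⟨(x - (6 * k + 7)) / 2, by omega, rfl⟩)), by grind⟩

lemma eq_zero_or_one_of_cLabel {n e : ℕ} (he : e < n) (h : cLabel n e = 1 ∨ cLabel n e = n) :
    e = 0 ∨ e = 1 := by
  by_contra! hne
  rcases Nat.mod_two_eq_zero_or_one e with hmod | hmod
  · rw [cLabel_of_even hmod] at h; omega
  · rw [cLabel_of_odd hmod] at h; omega

lemma chiLa_deleteEdges_eq_three {S : CycleMerging} (hk : 1 ≤ k)
    (hS : S = G0Two k ∨ S = G1One k ∨ S = G1Three k ∨ S = G2One k ∨ S = G2Three k ∨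
      S = G3One k ∨ S = G3Three k) {D : Set ℕ} (hD : D = ∅ ∨ D = {0} ∨ D = {1}) :
    chiLa (S.graph.deleteEdges D) = 3 := by
  rcases hS with rfl | rfl | rfl | rfl | rfl | rfl | rfl
  · exact isPairing_G0Two.chiLa_eq_three_of_pair (by grind [G0Two]) hD (by omega) (by grind [G0Two])
  · exact (isPairing_G1One hk).chiLa_eq_three_of_pair (by grind [G1One]) hD (by omega)
      (by grind [G1One])
  · exact isPairing_G1Three.chiLa_eq_three_of_pair (by grind [G1Three]) hD (by omega)
      (by grind [G1Three])
  · exact (isPairing_G2One hk).chiLa_eq_three_of_singleton (by grind [G2One]) hD (by grind [G2One])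
  · exact isPairing_G2Three.chiLa_eq_three_of_singleton (by grind [G2Three]) hD
      (by grind [G2Three])
  · exact (isPairing_G3One hk).chiLa_eq_three_of_mem (x := 6 * k + 2) (by grind [G3One]) hD
      (by simp) (by omega) (by grind [G3One])
  · exact isPairing_G3Three.chiLa_eq_three_of_mem (x := 2 * k + 2) (by grind [G3Three]) hD
      (by simp) (by omega) (by grind [G3Three])

end LocalAntimagic

theorem mainTheorem6_general (k : ℕ) (hk : 1 ≤ k) (S : LocalAntimagic.CycleMerging)
    (hS : S = LocalAntimagic.G0Two k ∨
      S = LocalAntimagic.G1One k ∨ S = LocalAntimagic.G1Three k ∨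
      S = LocalAntimagic.G2One k ∨ S = LocalAntimagic.G2Three k ∨
      S = LocalAntimagic.G3One k ∨ S = LocalAntimagic.G3Three k) :
    LocalAntimagic.chiLa S.graph = 3 ∧
      ∀ e ∈ S.graph.edgeSet,
        LocalAntimagic.cLabel S.n e = 1 ∨ LocalAntimagic.cLabel S.n e = S.n →
          LocalAntimagic.chiLa (S.graph.deleteEdges {e}) = 3 := by
  have key {D : Set ℕ} (hD : D = ∅ ∨ D = {0} ∨ D = {1}) :=
    LocalAntimagic.chiLa_deleteEdges_eq_three hk hS hD
  refine ⟨by simpa using key (.inl rfl), fun e he hlabel => key (.inr ?_)⟩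
  rcases LocalAntimagic.eq_zero_or_one_of_cLabel he hlabel with rfl | rfl
  exacts [.inl rfl, .inr rfl]

theorem mainTheorem6 (k : ℕ) (hk : 2 ≤ k) (S : LocalAntimagic.CycleMerging)
    (hS : S = LocalAntimagic.G0Two k ∨
      S = LocalAntimagic.G1One k ∨ S = LocalAntimagic.G1Three k ∨
      S = LocalAntimagic.G2One k ∨ S = LocalAntimagic.G2Three k ∨
      S = LocalAntimagic.G3One k ∨ S = LocalAntimagic.G3Three k) :
    LocalAntimagic.chiLa S.graph = 3 ∧
      ∀ e ∈ S.graph.edgeSet,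
        LocalAntimagic.cLabel S.n e = 1 ∨ LocalAntimagic.cLabel S.n e = S.n →
          LocalAntimagic.chiLa (S.graph.deleteEdges {e}) = 3 :=
  mainTheorem6_general k (by omega) S hS
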